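/- Let $(F,g_F)$ be a smooth Riemannian manifold without boundary, $\dim F=s$, let $f:F\to(0,\infty)$ be smooth, and let $I=(t_1,t_2)$ with $-\infty\le t_1<t_2\le\infty$. Let $M=I_f\times F$ be the standard static space-time, i.e. the manifold $I\times F$ with the Lorentzian metric $g=-f^2\,dt^2\oplus g_F$. Denote by $\mathrm{Ric}_{g_F},\tau_{g_F},\mathrm H^f_{g_F},\Delta_{g_F}f=\operatorname{tr}_{g_F}\mathrm H^f_{g_F}$ the Ricci tensor, the scalar curvature, the Hessian of $f$ and the Laplacian of $f$ on $(F,g_F)$, and put $$Q^f_{g_F}=\Delta_{g_F}f\,g_F-\mathrm H^f_{g_F},\qquad \mathscr L^*_{g_F}f=-f\,\mathrm{Ric}_{g_F}-\Delta_{g_F}f\,g_F+\mathrm H^f_{g_F}.$$ Let $T$ be the energy-momentum tensor of $(M,g)$ determined by the Einstein equation $\mathrm{Ric}-\tfrac12\tau g=8\pi T$, where $\mathrm{Ric}$ and $\tau$ are the Ricci tensor and the scalar curvature of $g$. A tangent vector $w$ is causal if $w\ne0$ and $g(w,w)\le0$; two causal vectors $w_1,w_2$ at the same point are in the same time-cone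 if there is a time-like vector $z$ at that point with $g(z,w_1)<0$ and $g(z,w_2)<0$. 1. If $\mathscr L^*_{g_F}f\equiv0$, then $8\pi T=-\tfrac12\tau_{g_F}\,g$. Moreover, in this case, $T(w_1,w_2)\ge0$ for all causal $w_1,w_2\in TM$ in the same time-cone if and only if $\tau_{g_F}\ge0$ on $F$. 2. If $(F,g_F)$ is Ricci flat, then for all $(t,x)\in I\times F$, $u_1,u_2\in T_tI$ and $v_1,v_2\in T_xF$, $$8\pi T(u_1+v_1,u_2+v_2)=\frac1{f(x)}\,Q^f_{g_F}(v_1,v_2).$$ Moreover, in this case, the following are equivalent: (a) $T(w_1,w_2)\ge0$ for all causal $w_1,w_2\in TM$ in the same time-cone; (b) $Q^f_{g_F}\equiv0$; (c) $\mathscr L^*_{g_F}f\equiv0$. -/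

import Mathlib

set_option maxSynthPendingDepth 3

open Set Manifold ContDiff TopologicalSpace

noncomputable section

namespace StaticSpacetime

/-! ### Tensor calculus in an open piece of a finite-dimensional vector space

Here `G : E → E →L[ℝ] E →L[ℝ] ℝ` is a (pseudo-Riemannian) metric written in coordinates. -/

section Coordinates

variable {E : Type*} [NormedAddCommGroup E] [NormedSpace ℝ E]

/-- Christoffel symbols of the first kind:
`(u, v, w) ↦ ½ (∂ᵤ G(v, w) + ∂ᵥ G(u, w) - ∂_w G(u, v))`. -/
def christoffelFirst (G : E → E →L[ℝ] E →L[ℝ] ℝ) (y : E) : E →L[ℝ] E →L[ℝ] E →L[ℝ] ℝ :=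
  let swap : (E →L[ℝ] E →L[ℝ] ℝ) →L[ℝ] (E →L[ℝ] E →L[ℝ] ℝ) :=
    (ContinuousLinearMap.flipₗᵢ ℝ E E ℝ).toContinuousLinearEquiv
  let D : E →L[ℝ] E →L[ℝ] E →L[ℝ] ℝ := fderiv ℝ G y
  let K : E →L[ℝ] E →L[ℝ] E →L[ℝ] ℝ := D + D.flip - swap.comp D.flip
  (1 / 2 : ℝ) • K

theorem christoffelFirst_apply (G : E → E →L[ℝ] E →L[ℝ] ℝ) (y u v w : E) :
    christoffelFirst G y u v w =
      1 / 2 * (fderiv ℝ G y u v w + fderiv ℝ G y v u w - fderiv ℝ G y w u v) := rfl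

/-- Christoffel symbols of the second kind, as the vector `Γ(u, v)` with
`G(Γ(u, v), w) = ½ (∂ᵤ G(v, w) + ∂ᵥ G(u, w) - ∂_w G(u, v))`; that is, the Levi-Civita derivative
of the constant field `v` in the direction `u`. -/
def christoffel (G : E → E →L[ℝ] E →L[ℝ] ℝ) (y : E) : E →L[ℝ] E →L[ℝ] E :=
  ContinuousLinearMap.compL ℝ E (E →L[ℝ] ℝ) E (G y).inverse ∘L christoffelFirst G y

theorem christoffel_apply (G : E → E →L[ℝ] E →L[ℝ] ℝ) (y u v : E) :
    christoffel G y u v = (G y).inverse (christoffelFirst G y u v) := rfl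

/-- For fixed `v`, `w`, the endomorphism `u ↦ R(u, v) w` of the curvature tensor. -/
def curvatureEnd (G : E → E →L[ℝ] E →L[ℝ] ℝ) (y v w : E) : E →L[ℝ] E :=
  ((fderiv ℝ (christoffel G) y).flip v).flip w - (fderiv ℝ (christoffel G) y v).flip w
    + (christoffel G y).flip (christoffel G y v w)
    - (christoffel G y v) ∘L (christoffel G y).flip w

/-- `R(u, v) w = (∂ᵤ Γ)(v, w) - (∂ᵥ Γ)(u, w) + Γ(u, Γ(v, w)) - Γ(v, Γ(u, w))`. -/
theorem curvatureEnd_apply (G : E → E →L[ℝ] E →L[ℝ] ℝ) (y u v w : E) :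
    curvatureEnd G y v w u =
      fderiv ℝ (christoffel G) y u v w - fderiv ℝ (christoffel G) y v u w
        + christoffel G y u (christoffel G y v w)
        - christoffel G y v (christoffel G y u w) := rfl

/-- The Ricci tensor `Ric(v, w) = tr (u ↦ R(u, v) w)` (positive on round spheres). -/
def coordRicci (G : E → E →L[ℝ] E →L[ℝ] ℝ) (y : E) : E →ₗ[ℝ] E →ₗ[ℝ] ℝ :=
  LinearMap.mk₂ ℝ (fun v w => LinearMap.trace ℝ E (curvatureEnd G y v w : E →ₗ[ℝ] E))
    (fun v v' w => by
      rw [← map_add]; congr 1; ext u; simp [curvatureEnd_apply]; abel)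
    (fun c v w => by
      rw [← map_smul]; congr 1; ext u; simp [curvatureEnd_apply, smul_add, smul_sub])
    (fun v w w' => by
      rw [← map_add]; congr 1; ext u; simp [curvatureEnd_apply]; abel)
    (fun c v w => by
      rw [← map_smul]; congr 1; ext u; simp [curvatureEnd_apply, smul_add, smul_sub])

/-- The Hessian `∇²h (v, w) = ∂ᵥ ∂_w h - dh (Γ(v, w))`. -/
def coordHessian (G : E → E →L[ℝ] E →L[ℝ] ℝ) (h : E → ℝ) (y : E) : E →ₗ[ℝ] E →ₗ[ℝ] ℝ :=
  LinearMap.mk₂ ℝ (fun v w => fderiv ℝ (fderiv ℝ h) y v w - fderiv ℝ h y (christoffel G y v w))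
    (fun v v' w => by simp; ring)
    (fun c v w => by simp; ring)
    (fun v w w' => by simp; ring)
    (fun c v w => by simp; ring)

/-- The metric trace `G^{ij} B_{ij}` of a bilinear form `B`, that is, the trace of the
endomorphism `A` with `G(A v, w) = B(v, w)`. -/
def metricTrace [FiniteDimensional ℝ E] (G : E →L[ℝ] E →L[ℝ] ℝ) (B : E →ₗ[ℝ] E →ₗ[ℝ] ℝ) : ℝ :=
  LinearMap.trace ℝ E
    ((G.inverse : (E →L[ℝ] ℝ) →ₗ[ℝ] E) ∘ₗ
      (LinearMap.toContinuousLinearMap : (E →ₗ[ℝ] ℝ) ≃ₗ[ℝ] (E →L[ℝ] ℝ)).toLinearMap ∘ₗ B)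

end Coordinates

/-! ### Tensor calculus on a manifold without boundary

All quantities at a point `x` are computed in the preferred chart at `x`; the value does not depend
on that choice, because these are tensors. -/

section Manifolds

variable {E : Type*} [NormedAddCommGroup E] [NormedSpace ℝ E]
  {H : Type*} [TopologicalSpace H] (I : ModelWithCorners ℝ E H) [I.Boundaryless]
  {N : Type*} [TopologicalSpace N] [ChartedSpace H N]

/-- A field of bilinear forms on the tangent spaces, such as a pseudo-Riemannian metric. -/
abbrev MetricField (N : Type*) [TopologicalSpace N] [ChartedSpace H N] : Type _ :=
  (x : N) → TangentSpace I x →L[ℝ] TangentSpace I x →L[ℝ] ℝ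

/-- The metric `g` written in the chart at `x`: its pullback under the inverse of the chart. -/
def coordMetric (g : MetricField I N) (x : N) (y : E) : E →L[ℝ] E →L[ℝ] ℝ :=
  let A : E →L[ℝ] E := mfderivWithin 𝓘(ℝ, E) I (extChartAt I x).symm (range I) y
  let B : E →L[ℝ] E →L[ℝ] ℝ := g ((extChartAt I x).symm y)
  B.bilinearComp A A

/-- The differential at `x` of the chart at `x`. -/
def chartDeriv (x : N) : TangentSpace I x →ₗ[ℝ] E :=
  let D : E →L[ℝ] E := mfderiv I 𝓘(ℝ, E) (extChartAt I x) x
  (D : E →ₗ[ℝ] E)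

/-- The Ricci tensor of the Levi-Civita connection of `g`. -/
def ricci (g : MetricField I N) (x : N) : TangentSpace I x →ₗ[ℝ] TangentSpace I x →ₗ[ℝ] ℝ :=
  (coordRicci (coordMetric I g x) (extChartAt I x x)).compl₁₂ (chartDeriv I x) (chartDeriv I x)

/-- The scalar curvature of `g`: the metric trace of the Ricci tensor. -/
def scalarCurvature [FiniteDimensional ℝ E] (g : MetricField I N) (x : N) : ℝ :=
  metricTrace (coordMetric I g x (extChartAt I x x))
    (coordRicci (coordMetric I g x) (extChartAt I x x))

/-- The Hessian tensor of the function `h` with respect to `g`. -/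
def hessian (g : MetricField I N) (h : N → ℝ) (x : N) :
    TangentSpace I x →ₗ[ℝ] TangentSpace I x →ₗ[ℝ] ℝ :=
  (coordHessian (coordMetric I g x) (h ∘ (extChartAt I x).symm) (extChartAt I x x)).compl₁₂
    (chartDeriv I x) (chartDeriv I x)

/-- The Laplace-Beltrami operator: the metric trace of the Hessian. -/
def laplacian [FiniteDimensional ℝ E] (g : MetricField I N) (h : N → ℝ) (x : N) : ℝ :=
  metricTrace (coordMetric I g x (extChartAt I x x))
    (coordHessian (coordMetric I g x) (h ∘ (extChartAt I x).symm) (extChartAt I x x))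

/-- The tensor `Q_g^h = (Δ_g h) g - Hess_g h`. -/
def tensorQ [FiniteDimensional ℝ E] (g : MetricField I N) (h : N → ℝ) (x : N)
    (v w : TangentSpace I x) : ℝ :=
  laplacian I g h x * g x v w - hessian I g h x v w

/-- The tensor `L_g^* h = - h Ric_g - (Δ_g h) g + Hess_g h`. -/
def tensorLstar [FiniteDimensional ℝ E] (g : MetricField I N) (h : N → ℝ) (x : N)
    (v w : TangentSpace I x) : ℝ :=
  -(h x * ricci I g x v w) - laplacian I g h x * g x v w + hessian I g h x v w

/-- The energy-momentum tensor given by the Einstein equation `Ric - ½ τ g = 8 π T`. -/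
def energyMomentum [FiniteDimensional ℝ E] (g : MetricField I N) (x : N)
    (v w : TangentSpace I x) : ℝ :=
  1 / (8 * Real.pi) * (ricci I g x v w - 1 / 2 * scalarCurvature I g x * g x v w)

/-- A causal tangent vector: non-zero, and time-like or null. -/
def IsCausal (g : MetricField I N) {x : N} (w : TangentSpace I x) : Prop :=
  w ≠ 0 ∧ g x w w ≤ 0

/-- The vectors `w₁`, `w₂` lie in the same (closed) time-cone, namely in that of some time-like
vector `z`. -/
def SameTimeCone (g : MetricField I N) {x : N} (w₁ w₂ : TangentSpace I x) : Prop :=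
  ∃ z : TangentSpace I x, g x z z < 0 ∧ g x z w₁ < 0 ∧ g x z w₂ < 0

/-- `T(w₁, w₂) ≥ 0` for all causal vectors `w₁`, `w₂` in the same time-cone. -/
def DominantCondition [FiniteDimensional ℝ E] (g : MetricField I N) : Prop :=
  ∀ (x : N) (w₁ w₂ : TangentSpace I x), IsCausal I g w₁ → IsCausal I g w₂ →
    SameTimeCone I g w₁ w₂ → 0 ≤ energyMomentum I g x w₁ w₂

end Manifolds

/-! ### Standard static space-times -/

section Static

/-- The open interval `(t₁, t₂)`, possibly unbounded, as an open subset of `ℝ`. -/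
def openInterval (t₁ t₂ : EReal) : Opens ℝ :=
  ⟨{t : ℝ | t₁ < (t : EReal) ∧ (t : EReal) < t₂},
    (isOpen_lt continuous_const continuous_coe_real_ereal).inter
      (isOpen_lt continuous_coe_real_ereal continuous_const)⟩

variable {s : ℕ} (t₁ t₂ : EReal) (F : Type*) [TopologicalSpace F]
  [ChartedSpace (EuclideanSpace ℝ (Fin s)) F]

/-- The model with corners of the product of an interval and an `s`-dimensional manifold. -/
abbrev staticModel (s : ℕ) : ModelWithCorners ℝ (ℝ × EuclideanSpace ℝ (Fin s))
    (ModelProd ℝ (EuclideanSpace ℝ (Fin s))) :=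
  𝓘(ℝ, ℝ).prod (𝓡 s)

variable {F}

/-- The differential `dt` of the time coordinate `(t, x) ↦ t`. -/
def timeForm (p : openInterval t₁ t₂ × F) : TangentSpace (staticModel s) p →L[ℝ] ℝ :=
  mfderiv (staticModel s) 𝓘(ℝ, ℝ) (fun q : openInterval t₁ t₂ × F => (q.1 : ℝ)) p

/-- The differential of the projection onto the fiber `F`. -/
def fiberProj (p : openInterval t₁ t₂ × F) :
    TangentSpace (staticModel s) p →L[ℝ] TangentSpace (𝓡 s) p.2 :=
  mfderiv (staticModel s) (𝓡 s) (Prod.snd : openInterval t₁ t₂ × F → F) p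

/-- The metric `-f² dt² ⊕ g_F` of the standard static space-time `(t₁, t₂) _f × F`. -/
def staticMetric (gF : MetricField (𝓡 s) F) (f : F → ℝ) :
    MetricField (staticModel s) (openInterval t₁ t₂ × F) := fun p =>
  let dt : ℝ × EuclideanSpace ℝ (Fin s) →L[ℝ] ℝ := timeForm t₁ t₂ p
  let P : ℝ × EuclideanSpace ℝ (Fin s) →L[ℝ] EuclideanSpace ℝ (Fin s) := fiberProj t₁ t₂ p
  let B : EuclideanSpace ℝ (Fin s) →L[ℝ] EuclideanSpace ℝ (Fin s) →L[ℝ] ℝ := gF p.2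
  B.bilinearComp P P - (f p.2) ^ 2 • (ContinuousLinearMap.mul ℝ ℝ).bilinearComp dt dt

theorem staticMetric_apply (gF : MetricField (𝓡 s) F) (f : F → ℝ)
    (p : openInterval t₁ t₂ × F) (w₁ w₂ : TangentSpace (staticModel s) p) :
    staticMetric t₁ t₂ gF f p w₁ w₂ =
      gF p.2 (fiberProj t₁ t₂ p w₁) (fiberProj t₁ t₂ p w₂) -
        (f p.2) ^ 2 * (timeForm t₁ t₂ p w₁ * timeForm t₁ t₂ p w₂) := rfl

/-- The tangent vector `u + v` at `(t, x)` with `u ∈ T_t I` and `v ∈ T_x F`: the sum of the images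
under the differentials of the two inclusions `I × {x}` and `{t} × F`. -/
def sumVector (t : openInterval t₁ t₂) (x : F) (u : TangentSpace 𝓘(ℝ, ℝ) t)
    (v : TangentSpace (𝓡 s) x) : TangentSpace (staticModel s) (t, x) :=
  mfderiv 𝓘(ℝ, ℝ) (staticModel s) (fun t' : openInterval t₁ t₂ => (t', x)) t u +
    mfderiv (𝓡 s) (staticModel s) (fun x' : F => (t, x')) x v

end Static

end StaticSpacetime

end

noncomputable section

open scoped Topology
open Filter

namespace StaticSpacetime

section Coordinates

variable {E : Type*} [NormedAddCommGroup E] [NormedSpace ℝ E]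

/-! Everything follows from one identity, `energyMomentum_staticMetric`: 8πT = -½ τ_F g - (1/f) L*f,
with L*f evaluated on the fiber parts. It comes from Ric = Ric_F - Hess f / f + f Δf dt² and τ = τ_F
- 2 Δf / f: in Ric - ½ τ g the dt² terms containing Δf cancel, and what remains on the fiber is -L*f
/ f.

The two curvature formulas are computed for the model metric -φ² dt² + G on ℝ × E
(`coordRicci_staticCoord`, `metricTrace_coordRicci_staticCoord`). They transfer to the manifold
because in a product chart the metric has exactly this form near the point
(`coordMetric_staticMetric`).

If L*f = 0, the sign of T is governed by -τ_F g. The reverse Cauchy-Schwarz inequality gives g(w₁,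
w₂) ≤ 0 for causal vectors in one cone (`staticMetric_nonpos_of_sameTimeCone`), and a time-like
vector paired with itself gives the converse.

If F is Ricci flat, then τ_F = 0 and Q = -L*f, so T sees only the fiber parts. Any two fiber vectors
are the fiber parts of causal vectors in one cone, once the time parts are large
(`exists_causal_lift`). The energy condition thus makes the bilinear form Q nonnegative on all
pairs, and replacing w by -w forces Q = 0. -/

theorem _root_.HasFDerivAt.clm_apply_const₂ {E₁ E₂ E₃ E₄ : Type*}
    [NormedAddCommGroup E₁] [NormedSpace ℝ E₁] [NormedAddCommGroup E₂] [NormedSpace ℝ E₂]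
    [NormedAddCommGroup E₃] [NormedSpace ℝ E₃] [NormedAddCommGroup E₄] [NormedSpace ℝ E₄]
    {B : E₁ → E₂ →L[ℝ] E₃ →L[ℝ] E₄} {B' : E₁ →L[ℝ] E₂ →L[ℝ] E₃ →L[ℝ] E₄} {y : E₁}
    (hB : HasFDerivAt B B' y) (a : E₂) (b : E₃) :
    HasFDerivAt (fun z => B z a b) ((B'.flip a).flip b) y := by
  have h := (hB.clm_apply (hasFDerivAt_const a y)).clm_apply (hasFDerivAt_const b y)
  refine h.congr_fderiv ?_
  ext x
  simp

/-! ### Locality and differentiability of the coordinate tensors -/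

theorem christoffel_eventuallyEq {G₁ G₂ : E → E →L[ℝ] E →L[ℝ] ℝ} {y : E} (h : G₁ =ᶠ[𝓝 y] G₂) :
    christoffel G₁ =ᶠ[𝓝 y] christoffel G₂ := by
  filter_upwards [h, h.fderiv (𝕜 := ℝ)] with z hz hz'
  ext u v
  simp only [christoffel_apply, hz]
  congr 1
  ext w
  simp only [christoffelFirst_apply, hz']

/-- Curvature depends only on the germ of the metric. This is needed because the product form of the
space-time metric is available only on a chart target. -/
theorem coordRicci_congr {G₁ G₂ : E → E →L[ℝ] E →L[ℝ] ℝ} {y : E} (h : G₁ =ᶠ[𝓝 y] G₂) :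
    coordRicci G₁ y = coordRicci G₂ y := by
  have h₁ := christoffel_eventuallyEq h
  ext v w
  simp only [coordRicci, LinearMap.mk₂_apply]
  congr 2
  ext u
  simp only [curvatureEnd_apply, h₁.eq_of_nhds, h₁.fderiv_eq]

/-- Lets a guessed Christoffel vector be verified by pairing it with test vectors, without computing
the inverse metric. -/
theorem christoffel_eq_iff {G : E → E →L[ℝ] E →L[ℝ] ℝ} {y : E} (hG : (G y).IsInvertible)
    {u v X : E} :
    christoffel G y u v = X ↔ ∀ w, christoffelFirst G y u v w = G y X w := by
  rw [christoffel_apply, hG.inverse_apply_eq, ContinuousLinearMap.ext_iff]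

theorem metric_christoffel {G : E → E →L[ℝ] E →L[ℝ] ℝ} {y : E} (hG : (G y).IsInvertible)
    (u v w : E) : G y (christoffel G y u v) w = christoffelFirst G y u v w :=
  ((christoffel_eq_iff hG).1 rfl w).symm

theorem differentiableAt_christoffel [CompleteSpace E] {G : E → E →L[ℝ] E →L[ℝ] ℝ} {y : E}
    (hG : ContDiffAt ℝ 2 G y) (hinv : (G y).IsInvertible) :
    DifferentiableAt ℝ (christoffel G) y := by
  have hD : DifferentiableAt ℝ (fderiv ℝ G) y :=
    (hG.fderiv_right (m := 1) (by norm_num)).differentiableAt (by norm_num)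
  have hI : DifferentiableAt ℝ (fun z => (G z).inverse) y :=
    ((hinv.contDiffAt_map_inverse (n := 1)).differentiableAt (by norm_num)).comp y
      (hG.differentiableAt (by norm_num))
  have hflip : DifferentiableAt ℝ (fun z => (fderiv ℝ G z).flip) y :=
    (ContinuousLinearMap.flipₗᵢ ℝ E E
      (E →L[ℝ] ℝ)).toContinuousLinearEquiv.differentiableAt.comp y hD
  have hF : DifferentiableAt ℝ (christoffelFirst G) y :=
    ((hD.add hflip).sub ((differentiableAt_const _).clm_comp hflip)).const_smul (1 / 2 : ℝ)
  exact ((ContinuousLinearMap.compL ℝ E (E →L[ℝ] ℝ) E).differentiableAt.comp y hI).clm_comp hF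

theorem eventually_isInvertible [CompleteSpace E] {G : E → E →L[ℝ] E →L[ℝ] ℝ} {y : E}
    (hG : ContinuousAt G y) (hinv : (G y).IsInvertible) : ∀ᶠ z in 𝓝 y, (G z).IsInvertible := by
  obtain ⟨e, he⟩ := hinv
  have h : ∀ᶠ T in 𝓝 (G y), ContinuousLinearMap.IsInvertible T := by
    rw [← he]
    exact e.nhds
  exact hG.eventually h

theorem fderiv_symm_of_eventually {G : E → E →L[ℝ] E →L[ℝ] ℝ} {y : E}
    (hG : DifferentiableAt ℝ G y) (hsymm : ∀ᶠ z in 𝓝 y, ∀ u v, G z u v = G z v u) (w u v : E) :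
    fderiv ℝ G y w u v = fderiv ℝ G y w v u := by
  have key (a b : E) := hG.hasFDerivAt.clm_apply_const₂ a b
  have h := (key v u).congr_of_eventuallyEq
    (show (fun z => G z u v) =ᶠ[𝓝 y] fun z => G z v u from hsymm.mono fun z hz => hz u v)
  exact DFunLike.congr_fun ((key u v).unique h) w

/-- The Levi-Civita connection is compatible with the metric. -/
theorem fderiv_metric {G : E → E →L[ℝ] E →L[ℝ] ℝ} {y : E}
    (hG : DifferentiableAt ℝ G y) (hsymm : ∀ᶠ z in 𝓝 y, ∀ u v, G z u v = G z v u)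
    (hinv : (G y).IsInvertible) (u v w : E) :
    fderiv ℝ G y u v w = G y (christoffel G y u v) w + G y (christoffel G y u w) v := by
  rw [metric_christoffel hinv, metric_christoffel hinv]
  simp only [christoffelFirst_apply]
  rw [fderiv_symm_of_eventually hG hsymm u w v, fderiv_symm_of_eventually hG hsymm v u w,
    fderiv_symm_of_eventually hG hsymm w u v]
  ring

/-! ### Gradient and Laplacian in coordinates -/

/-- The gradient of `h` with respect to the metric `G`. -/
def coordGrad (G : E → E →L[ℝ] E →L[ℝ] ℝ) (h : E → ℝ) (y : E) : E :=
  (G y).inverse (fderiv ℝ h y)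

theorem metric_coordGrad {G : E → E →L[ℝ] E →L[ℝ] ℝ} {h : E → ℝ} {y : E}
    (hinv : (G y).IsInvertible) (w : E) : G y (coordGrad G h y) w = fderiv ℝ h y w := by
  rw [coordGrad, hinv.self_apply_inverse]

theorem differentiableAt_coordGrad [CompleteSpace E] {G : E → E →L[ℝ] E →L[ℝ] ℝ} {h : E → ℝ}
    {y : E} (hG : DifferentiableAt ℝ G y) (hh : ContDiffAt ℝ 2 h y) (hinv : (G y).IsInvertible) :
    DifferentiableAt ℝ (coordGrad G h) y := by
  have hI : DifferentiableAt ℝ (fun z => (G z).inverse) y :=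
    ((hinv.contDiffAt_map_inverse (n := 1)).differentiableAt (by norm_num)).comp y hG
  exact hI.clm_apply ((hh.fderiv_right (m := 1) (by norm_num)).differentiableAt (by norm_num))

/-- The Hessian is the covariant derivative of the gradient, with an index lowered. -/
theorem coordHessian_eq_metric [CompleteSpace E] {G : E → E →L[ℝ] E →L[ℝ] ℝ} {h : E → ℝ} {y : E}
    (hG : ContDiffAt ℝ 2 G y) (hh : ContDiffAt ℝ 2 h y)
    (hsymm : ∀ᶠ z in 𝓝 y, ∀ u v, G z u v = G z v u) (hinv : (G y).IsInvertible) (u w : E) :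
    coordHessian G h y u w =
      G y (fderiv ℝ (coordGrad G h) y u + christoffel G y u (coordGrad G h y)) w := by
  have hG₁ : DifferentiableAt ℝ G y := hG.differentiableAt (by norm_num)
  have hN := differentiableAt_coordGrad hG₁ hh hinv
  have hD : DifferentiableAt ℝ (fderiv ℝ h) y :=
    (hh.fderiv_right (m := 1) (by norm_num)).differentiableAt (by norm_num)
  -- Differentiate G(∇h, w) = dh(w) along u. Metric compatibility splits the derivative of G into
  -- G(Γ(u, ∇h), w) and dh(Γ(u, w)); the latter is the correction term of the Hessian.
  have h₁ := (hG₁.hasFDerivAt.clm_apply hN.hasFDerivAt).clm_apply (hasFDerivAt_const w y)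
  have h₂ := hD.hasFDerivAt.clm_apply (hasFDerivAt_const w y)
  have heq : (fun z => G z (coordGrad G h z) w) =ᶠ[𝓝 y] fun z => fderiv ℝ h z w :=
    (eventually_isInvertible hG₁.continuousAt hinv).mono fun z hz => metric_coordGrad hz w
  have h₃ := DFunLike.congr_fun (h₁.unique (h₂.congr_of_eventuallyEq heq)) u
  simp only [add_apply, ContinuousLinearMap.comp_apply,
    ContinuousLinearMap.flip_apply, zero_apply, map_zero, zero_add] at h₃
  rw [fderiv_metric hG₁ hsymm hinv, hsymm.self_of_nhds _ (coordGrad G h y),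
    metric_coordGrad hinv] at h₃
  simp only [coordHessian, LinearMap.mk₂_apply, map_add, add_apply]
  linarith

/-- Raising an index turns the Hessian into u ↦ ∇ᵤ grad h, the form in which the Laplacian appears
in the curvature of the static metric. -/
theorem metricTrace_coordHessian [FiniteDimensional ℝ E] {G : E → E →L[ℝ] E →L[ℝ] ℝ} {h : E → ℝ}
    {y : E} (hG : ContDiffAt ℝ 2 G y) (hh : ContDiffAt ℝ 2 h y)
    (hsymm : ∀ᶠ z in 𝓝 y, ∀ u v, G z u v = G z v u) (hinv : (G y).IsInvertible) :
    metricTrace (G y) (coordHessian G h y) =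
      LinearMap.trace ℝ E ((fderiv ℝ (coordGrad G h) y +
        (christoffel G y).flip (coordGrad G h y) : E →L[ℝ] E) : E →ₗ[ℝ] E) := by
  have : CompleteSpace E := FiniteDimensional.complete ℝ E
  rw [metricTrace]
  congr 1
  ext u
  simp only [LinearMap.comp_apply, ContinuousLinearMap.coe_coe]
  rw [hinv.inverse_apply_eq]
  ext w
  exact coordHessian_eq_metric hG hh hsymm hinv u w

end Coordinates

section StaticCoordinates

variable {E : Type*} [NormedAddCommGroup E] [NormedSpace ℝ E]

/-! ### The metric `-φ² dt² + G` on `ℝ × E` -/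

/-- The metric `-φ² dt² + G` on `ℝ × E`. -/
def staticCoord (G : E → E →L[ℝ] E →L[ℝ] ℝ) (φ : E → ℝ) (q : ℝ × E) :
    ℝ × E →L[ℝ] ℝ × E →L[ℝ] ℝ :=
  (G q.2).bilinearComp (.snd ℝ ℝ E) (.snd ℝ ℝ E) -
    (φ q.2) ^ 2 • (ContinuousLinearMap.mul ℝ ℝ).bilinearComp (.fst ℝ ℝ E) (.fst ℝ ℝ E)

theorem staticCoord_apply (G : E → E →L[ℝ] E →L[ℝ] ℝ) (φ : E → ℝ) (q V W : ℝ × E) :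
    staticCoord G φ q V W = G q.2 V.2 W.2 - φ q.2 ^ 2 * (V.1 * W.1) := rfl

variable {G : E → E →L[ℝ] E →L[ℝ] ℝ} {φ : E → ℝ} {q : ℝ × E}

theorem contDiffAt_staticCoord {n : ℕ∞ω} (hG : ContDiffAt ℝ n G q.2) (hφ : ContDiffAt ℝ n φ q.2) :
    ContDiffAt ℝ n (staticCoord G φ) q := by
  have hG' : ContDiffAt ℝ n (fun q : ℝ × E => G q.2) q := hG.comp q contDiffAt_snd
  have hφ' : ContDiffAt ℝ n (fun q : ℝ × E => φ q.2) q := hφ.comp q contDiffAt_snd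
  -- `bilinearComp` is two rounds of composing and flipping, each of which preserves smoothness.
  have h₁ := (ContinuousLinearMap.flipₗᵢ ℝ (ℝ × E) E ℝ).toContinuousLinearEquiv.contDiff.contDiffAt.comp
    q (hG'.clm_comp (contDiffAt_const (c := ContinuousLinearMap.snd ℝ ℝ E)))
  have h₂ := (ContinuousLinearMap.flipₗᵢ ℝ (ℝ × E) (ℝ × E)
    ℝ).toContinuousLinearEquiv.contDiff.contDiffAt.comp
    q (h₁.clm_comp (contDiffAt_const (c := ContinuousLinearMap.snd ℝ ℝ E)))
  exact h₂.sub ((hφ'.pow 2).smul contDiffAt_const)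

/-- The inverse of the metric `-φ² dt² + G`. -/
def staticCoordInv (G : E → E →L[ℝ] E →L[ℝ] ℝ) (φ : E → ℝ) (q : ℝ × E) :
    (ℝ × E →L[ℝ] ℝ) →L[ℝ] ℝ × E :=
  (-(φ q.2 ^ 2)⁻¹ • ContinuousLinearMap.apply ℝ ℝ ((1, 0) : ℝ × E)).prod
    ((G q.2).inverse ∘L (ContinuousLinearMap.compL ℝ E (ℝ × E) ℝ).flip (.inr ℝ ℝ E))

theorem staticCoordInv_apply (L : ℝ × E →L[ℝ] ℝ) :
    staticCoordInv G φ q L =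
      (-(φ q.2 ^ 2)⁻¹ * L (1, 0), (G q.2).inverse (L ∘L .inr ℝ ℝ E)) := rfl

theorem staticCoord_comp_inv (hinv : (G q.2).IsInvertible) (hφ : φ q.2 ≠ 0) :
    staticCoord G φ q ∘L staticCoordInv G φ q = .id ℝ _ := by
  ext L : 1
  refine ContinuousLinearMap.ext fun W => ?_
  have hW : L W = W.1 * L (1, 0) + L (0, W.2) := by
    rw [← smul_eq_mul, ← map_smul, ← map_add]
    simp
  simp only [ContinuousLinearMap.comp_apply, staticCoord_apply, staticCoordInv_apply,
    hinv.self_apply_inverse, ContinuousLinearMap.id_apply, ContinuousLinearMap.inr_apply, hW]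
  field_simp
  ring

theorem staticCoordInv_comp (hinv : (G q.2).IsInvertible) (hφ : φ q.2 ≠ 0) :
    staticCoordInv G φ q ∘L staticCoord G φ q = .id ℝ _ := by
  refine ContinuousLinearMap.ext fun V => ?_
  have h : (staticCoord G φ q V) ∘L .inr ℝ ℝ E = G q.2 V.2 := by
    ext w
    simp [staticCoord_apply]
  simp only [ContinuousLinearMap.comp_apply, staticCoordInv_apply, h, hinv.inverse_apply_self]
  ext
  · simp [staticCoord_apply]
    field_simp
  · simp

theorem isInvertible_staticCoord (hinv : (G q.2).IsInvertible) (hφ : φ q.2 ≠ 0) :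
    (staticCoord G φ q).IsInvertible :=
  .of_inverse (staticCoord_comp_inv hinv hφ) (staticCoordInv_comp hinv hφ)

theorem inverse_staticCoord (hinv : (G q.2).IsInvertible) (hφ : φ q.2 ≠ 0) :
    (staticCoord G φ q).inverse = staticCoordInv G φ q :=
  ContinuousLinearMap.inverse_eq (staticCoord_comp_inv hinv hφ) (staticCoordInv_comp hinv hφ)

theorem fderiv_staticCoord (hG : DifferentiableAt ℝ G q.2) (hφ : DifferentiableAt ℝ φ q.2)
    (hS : DifferentiableAt ℝ (staticCoord G φ) q) (U V W : ℝ × E) :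
    fderiv ℝ (staticCoord G φ) q U V W =
      fderiv ℝ G q.2 U.2 V.2 W.2 - 2 * φ q.2 * fderiv ℝ φ q.2 U.2 * (V.1 * W.1) := by
  have h₁ := hS.hasFDerivAt.clm_apply_const₂ V W
  have h₂ : HasFDerivAt (fun q : ℝ × E => G q.2 V.2 W.2) _ q :=
    (hG.hasFDerivAt.clm_apply_const₂ V.2 W.2).comp q hasFDerivAt_snd
  have h₃ : HasFDerivAt (fun q : ℝ × E => φ q.2) _ q := hφ.hasFDerivAt.comp q hasFDerivAt_snd
  have h₄ := DFunLike.congr_fun (h₁.unique (h₂.sub ((h₃.pow 2).mul_const (V.1 * W.1)))) U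
  simp only [ContinuousLinearMap.flip_apply] at h₄
  rw [h₄]
  simp
  ring

/-- The Christoffel symbols of the metric `-φ² dt² + G`. -/
theorem christoffel_staticCoord (hG : DifferentiableAt ℝ G q.2) (hφ : DifferentiableAt ℝ φ q.2)
    (hS : DifferentiableAt ℝ (staticCoord G φ) q) (hinv : (G q.2).IsInvertible)
    (hφ₀ : φ q.2 ≠ 0) (V W : ℝ × E) :
    christoffel (staticCoord G φ) q V W =
      (V.1 * ((φ q.2)⁻¹ * fderiv ℝ φ q.2 W.2) + W.1 * ((φ q.2)⁻¹ * fderiv ℝ φ q.2 V.2),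
        christoffel G q.2 V.2 W.2 + (V.1 * W.1) • φ q.2 • coordGrad G φ q.2) := by
  rw [christoffel_eq_iff (isInvertible_staticCoord hinv hφ₀)]
  intro Z
  simp only [christoffelFirst_apply, fderiv_staticCoord hG hφ hS, staticCoord_apply, map_add,
    map_smul, add_apply, smul_apply,
    metric_christoffel hinv, metric_coordGrad hinv, smul_eq_mul]
  field_simp
  ring

/-- The derivative of the Christoffel symbols of the metric `-φ² dt² + G`. -/
theorem fderiv_christoffel_staticCoord [FiniteDimensional ℝ E] (hG : ContDiffAt ℝ 2 G q.2)
    (hφ : ContDiffAt ℝ 2 φ q.2) (hinv : (G q.2).IsInvertible)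
    (hφ₀ : φ q.2 ≠ 0) (U V W : ℝ × E) :
    fderiv ℝ (christoffel (staticCoord G φ)) q U V W =
      (V.1 * ((φ q.2)⁻¹ * fderiv ℝ (fderiv ℝ φ) q.2 U.2 W.2 -
          (φ q.2 ^ 2)⁻¹ * fderiv ℝ φ q.2 U.2 * fderiv ℝ φ q.2 W.2) +
        W.1 * ((φ q.2)⁻¹ * fderiv ℝ (fderiv ℝ φ) q.2 U.2 V.2 -
          (φ q.2 ^ 2)⁻¹ * fderiv ℝ φ q.2 U.2 * fderiv ℝ φ q.2 V.2),
        fderiv ℝ (christoffel G) q.2 U.2 V.2 W.2 +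
          (V.1 * W.1) • (φ q.2 • fderiv ℝ (coordGrad G φ) q.2 U.2 +
            fderiv ℝ φ q.2 U.2 • coordGrad G φ q.2)) := by
  have : CompleteSpace E := FiniteDimensional.complete ℝ E
  have hG₁ : DifferentiableAt ℝ G q.2 := hG.differentiableAt (by norm_num)
  have hφ₁ : DifferentiableAt ℝ φ q.2 := hφ.differentiableAt (by norm_num)
  have hD : DifferentiableAt ℝ (fderiv ℝ φ) q.2 :=
    (hφ.fderiv_right (m := 1) (by norm_num)).differentiableAt (by norm_num)
  have hN := differentiableAt_coordGrad hG₁ hφ hinv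
  have hΓ := differentiableAt_christoffel hG hinv
  have hS := contDiffAt_staticCoord hG hφ
  have hdS := (differentiableAt_christoffel hS
    (isInvertible_staticCoord hinv hφ₀)).hasFDerivAt.clm_apply_const₂ V W
  have hsnd : Tendsto (Prod.snd : ℝ × E → E) (𝓝 q) (𝓝 q.2) := continuous_snd.tendsto q
  -- The hypotheses of the Christoffel formula are open conditions, so it holds near q and may be
  -- differentiated.
  have heq : (fun q => christoffel (staticCoord G φ) q V W) =ᶠ[𝓝 q] fun q : ℝ × E =>
      (V.1 * ((φ q.2)⁻¹ * fderiv ℝ φ q.2 W.2) + W.1 * ((φ q.2)⁻¹ * fderiv ℝ φ q.2 V.2),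
        christoffel G q.2 V.2 W.2 + (V.1 * W.1) • φ q.2 • coordGrad G φ q.2) := by
    filter_upwards [hsnd.eventually (hG.eventually (by simp)),
      hsnd.eventually (hφ.eventually (by simp)), hS.eventually (by simp),
      hsnd.eventually (eventually_isInvertible hG₁.continuousAt hinv),
      hsnd.eventually (hφ₁.continuousAt.eventually_ne hφ₀)] with z h₁ h₂ h₃ h₄ h₅
    exact christoffel_staticCoord (h₁.differentiableAt (by norm_num))
      (h₂.differentiableAt (by norm_num)) (h₃.differentiableAt (by norm_num)) h₄ h₅ V W
  have hψ (w : E) : HasFDerivAt (fun z => (φ z)⁻¹ * fderiv ℝ φ z w) _ q.2 :=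
    ((hasDerivAt_inv hφ₀).comp_hasFDerivAt q.2 hφ₁.hasFDerivAt).mul (hD.hasFDerivAt.clm_apply (hasFDerivAt_const w q.2))
  have hR := (((hψ W.2).const_mul V.1).add ((hψ V.2).const_mul W.1)).prodMk
    ((hΓ.hasFDerivAt.clm_apply_const₂ V.2 W.2).add
      ((hφ₁.hasFDerivAt.smul hN.hasFDerivAt).const_smul (V.1 * W.1)))
  have hR' := hR.comp q (hasFDerivAt_snd (𝕜 := ℝ) (E := ℝ) (F := E) (p := q))
  have key := DFunLike.congr_fun (hdS.unique (hR'.congr_of_eventuallyEq heq)) U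
  simp only [ContinuousLinearMap.flip_apply] at key
  rw [key]
  ext
  · simp
    ring
  · simp

/-- Split the identity through the two factors; cyclicity of the trace moves each half to its own
factor, leaving the diagonal blocks. -/
theorem trace_real_prod [FiniteDimensional ℝ E] (T : ℝ × E →ₗ[ℝ] ℝ × E) :
    LinearMap.trace ℝ (ℝ × E) T =
      (T (1, 0)).1 + LinearMap.trace ℝ E (.snd ℝ ℝ E ∘ₗ T ∘ₗ .inr ℝ ℝ E) := by
  have hT : T = T ∘ₗ (.inl ℝ ℝ E ∘ₗ .fst ℝ ℝ E) + T ∘ₗ (.inr ℝ ℝ E ∘ₗ .snd ℝ ℝ E) := by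
    rw [← LinearMap.comp_add]
    ext <;> simp
  conv_lhs => rw [hT]
  rw [map_add, ← LinearMap.comp_assoc, ← LinearMap.comp_assoc, LinearMap.trace_comp_comm',
    LinearMap.trace_comp_comm' (T ∘ₗ .inr ℝ ℝ E)]
  congr 1
  rw [show .fst ℝ ℝ E ∘ₗ T ∘ₗ .inl ℝ ℝ E = (T (1, 0)).1 • LinearMap.id from by ext; simp]
  simp

/-- The time block of the trace defining Ric; it produces the term -Hess φ / φ. -/
theorem curvatureEnd_staticCoord_time [FiniteDimensional ℝ E] (hG : ContDiffAt ℝ 2 G q.2)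
    (hφ : ContDiffAt ℝ 2 φ q.2) (hinv : (G q.2).IsInvertible)
    (hφ₀ : φ q.2 ≠ 0) (V W : ℝ × E) :
    (curvatureEnd (staticCoord G φ) q V W (1, 0)).1 =
      -((φ q.2)⁻¹ * coordHessian G φ q.2 V.2 W.2) := by
  have hG₁ : DifferentiableAt ℝ G q.2 := hG.differentiableAt (by norm_num)
  have hφ₁ : DifferentiableAt ℝ φ q.2 := hφ.differentiableAt (by norm_num)
  have hS := (contDiffAt_staticCoord hG hφ).differentiableAt (by norm_num)
  simp only [curvatureEnd_apply, fderiv_christoffel_staticCoord hG hφ hinv hφ₀,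
    christoffel_staticCoord hG₁ hφ₁ hS hinv hφ₀, coordHessian, LinearMap.mk₂_apply]
  simp
  field_simp
  ring

/-- The space block. The term dφ(u) grad φ from differentiating φ grad φ cancels against Γ(V, Γ(U,
W)), so only ∇ᵤ grad φ survives, whose trace is Δφ. -/
theorem curvatureEnd_staticCoord_space [FiniteDimensional ℝ E] (hG : ContDiffAt ℝ 2 G q.2)
    (hφ : ContDiffAt ℝ 2 φ q.2) (hinv : (G q.2).IsInvertible)
    (hφ₀ : φ q.2 ≠ 0) (V W : ℝ × E) (u : E) :
    (curvatureEnd (staticCoord G φ) q V W (0, u)).2 =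
      curvatureEnd G q.2 V.2 W.2 u + (V.1 * W.1 * φ q.2) •
        (fderiv ℝ (coordGrad G φ) q.2 u + christoffel G q.2 u (coordGrad G φ q.2)) := by
  have hG₁ : DifferentiableAt ℝ G q.2 := hG.differentiableAt (by norm_num)
  have hφ₁ : DifferentiableAt ℝ φ q.2 := hφ.differentiableAt (by norm_num)
  have hS := (contDiffAt_staticCoord hG hφ).differentiableAt (by norm_num)
  simp only [curvatureEnd_apply, fderiv_christoffel_staticCoord hG hφ hinv hφ₀,
    christoffel_staticCoord hG₁ hφ₁ hS hinv hφ₀]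
  simp
  match_scalars <;> field_simp; ring

/-- The Ricci tensor of the metric `-φ² dt² + G`. -/
theorem coordRicci_staticCoord [FiniteDimensional ℝ E] (hG : ContDiffAt ℝ 2 G q.2)
    (hφ : ContDiffAt ℝ 2 φ q.2) (hsymm : ∀ᶠ z in 𝓝 q.2, ∀ u v, G z u v = G z v u)
    (hinv : (G q.2).IsInvertible) (hφ₀ : φ q.2 ≠ 0) (V W : ℝ × E) :
    coordRicci (staticCoord G φ) q V W =
      coordRicci G q.2 V.2 W.2 - (φ q.2)⁻¹ * coordHessian G φ q.2 V.2 W.2 +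
        V.1 * W.1 * φ q.2 * metricTrace (G q.2) (coordHessian G φ q.2) := by
  rw [metricTrace_coordHessian hG hφ hsymm hinv]
  simp only [coordRicci, LinearMap.mk₂_apply]
  rw [trace_real_prod, ContinuousLinearMap.coe_coe,
    curvatureEnd_staticCoord_time hG hφ hinv hφ₀, ← smul_eq_mul (V.1 * W.1 * φ q.2), ← map_smul,
    sub_eq_neg_add, add_assoc, ← map_add]
  congr 2
  ext u
  exact curvatureEnd_staticCoord_space hG hφ hinv hφ₀ V W u

theorem metricTrace_sub_smul [FiniteDimensional ℝ E] (g : E →L[ℝ] E →L[ℝ] ℝ)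
    (B C : E →ₗ[ℝ] E →ₗ[ℝ] ℝ) (c : ℝ) :
    metricTrace g (B - c • C) = metricTrace g B - c * metricTrace g C := by
  simp only [metricTrace, LinearMap.comp_sub, LinearMap.comp_smul, map_sub, map_smul, smul_eq_mul]

/-- The scalar curvature of the metric `-φ² dt² + G`. -/
theorem metricTrace_coordRicci_staticCoord [FiniteDimensional ℝ E] (hG : ContDiffAt ℝ 2 G q.2)
    (hφ : ContDiffAt ℝ 2 φ q.2) (hsymm : ∀ᶠ z in 𝓝 q.2, ∀ u v, G z u v = G z v u)
    (hinv : (G q.2).IsInvertible) (hφ₀ : φ q.2 ≠ 0) :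
    metricTrace (staticCoord G φ q) (coordRicci (staticCoord G φ) q) =
      metricTrace (G q.2) (coordRicci G q.2) -
        2 * (φ q.2)⁻¹ * metricTrace (G q.2) (coordHessian G φ q.2) := by
  -- The inverse metric is block diagonal. Since Ric(∂ₜ, ∂ₜ) = φ Δφ, each block contributes one -Δφ
  -- / φ, whence the factor 2.
  have hsplit : metricTrace (staticCoord G φ q) (coordRicci (staticCoord G φ) q) =
      -(φ q.2 ^ 2)⁻¹ * coordRicci (staticCoord G φ) q (1, 0) (1, 0) +
        metricTrace (G q.2) (coordRicci G q.2 - (φ q.2)⁻¹ • coordHessian G φ q.2) := by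
    rw [metricTrace, trace_real_prod, inverse_staticCoord hinv hφ₀]
    congr 1
    rw [metricTrace]
    congr 1
    ext u
    simp only [LinearMap.comp_apply, LinearMap.inr_apply, LinearMap.snd_apply,
      ContinuousLinearMap.coe_coe, staticCoordInv_apply, LinearEquiv.coe_coe]
    congr 1
    ext w
    simp [coordRicci_staticCoord hG hφ hsymm hinv hφ₀]
  rw [hsplit, metricTrace_sub_smul, coordRicci_staticCoord hG hφ hsymm hinv hφ₀]
  simp
  field_simp
  ring

end StaticCoordinates

/-! ### Metrics read in charts -/

section Manifolds

variable {E : Type*} [NormedAddCommGroup E] [NormedSpace ℝ E]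
  {H : Type*} [TopologicalSpace H] (I : ModelWithCorners ℝ E H) [I.Boundaryless]
  {N : Type*} [TopologicalSpace N] [ChartedSpace H N]

theorem coordMetric_apply (g : MetricField I N) (x : N) (y V W : E) :
    coordMetric I g x y V W =
      g ((extChartAt I x).symm y) (mfderiv 𝓘(ℝ, E) I (extChartAt I x).symm y V)
        (mfderiv 𝓘(ℝ, E) I (extChartAt I x).symm y W) := by
  rw [← mfderivWithin_univ, ← I.range_eq_univ]
  rfl

end Manifolds

/-! ### The product chart of the space-time -/

section Static

variable {s : ℕ} {t₁ t₂ : EReal} {F : Type*} [TopologicalSpace F]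
  [ChartedSpace (EuclideanSpace ℝ (Fin s)) F]

theorem extChartAt_openInterval (t t' : openInterval t₁ t₂) :
    extChartAt 𝓘(ℝ, ℝ) t t' = (t' : ℝ) := by
  rfl

theorem coe_extChartAt_symm_openInterval (t : openInterval t₁ t₂) {r : ℝ}
    (hr : r ∈ (extChartAt 𝓘(ℝ, ℝ) t).target) :
    (((extChartAt 𝓘(ℝ, ℝ) t).symm r : openInterval t₁ t₂) : ℝ) = r := by
  rw [← extChartAt_openInterval t, (extChartAt 𝓘(ℝ, ℝ) t).right_inv hr]

theorem mdifferentiable_openInterval_coe :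
    MDifferentiable 𝓘(ℝ, ℝ) 𝓘(ℝ, ℝ) (fun t : openInterval t₁ t₂ => (t : ℝ)) :=
  (contMDiff_subtype_val (n := 1)).mdifferentiable (by norm_num)

theorem mdifferentiable_time :
    MDifferentiable (staticModel s) 𝓘(ℝ, ℝ) (fun q : openInterval t₁ t₂ × F => (q.1 : ℝ)) :=
  mdifferentiable_openInterval_coe.comp mdifferentiable_fst

theorem extChartAt_static_symm_apply (p : openInterval t₁ t₂ × F)
    (q : ℝ × EuclideanSpace ℝ (Fin s)) :
    (extChartAt (staticModel s) p).symm q =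
      ((extChartAt 𝓘(ℝ, ℝ) p.1).symm q.1, (extChartAt (𝓡 s) p.2).symm q.2) := by
  rw [extChartAt_prod]
  rfl

theorem extChartAt_static_apply (p q : openInterval t₁ t₂ × F) :
    extChartAt (staticModel s) p q = ((q.1 : ℝ), extChartAt (𝓡 s) p.2 q.2) := by
  rw [extChartAt_prod, ← extChartAt_openInterval p.1]
  rfl

variable [IsManifold (𝓡 s) ∞ F]

section

variable (p : openInterval t₁ t₂ × F) {q : ℝ × EuclideanSpace ℝ (Fin s)}
    (hq : q ∈ (extChartAt (staticModel s) p).target)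

include hq

theorem mdifferentiableAt_extChartAt_static_symm :
    MDifferentiableAt 𝓘(ℝ, ℝ × EuclideanSpace ℝ (Fin s)) (staticModel s)
      (extChartAt (staticModel s) p).symm q := by
  have h := mdifferentiableWithinAt_extChartAt_symm hq
  rwa [ModelWithCorners.range_eq_univ, mdifferentiableWithinAt_univ] at h

/-- Chain rule: time composed with the inverse chart is the first projection, though only on the
chart target, where the inverse chart of the interval is the identity on values. -/
theorem timeForm_extChartAt_symm (W : ℝ × EuclideanSpace ℝ (Fin s)) :
    timeForm t₁ t₂ ((extChartAt (staticModel s) p).symm q)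
      (mfderiv 𝓘(ℝ, ℝ × EuclideanSpace ℝ (Fin s)) (staticModel s)
        (extChartAt (staticModel s) p).symm q W) = W.1 := by
  have h := mfderiv_comp q (mdifferentiable_time _) (mdifferentiableAt_extChartAt_static_symm p hq)
  have heq : (fun q : openInterval t₁ t₂ × F => (q.1 : ℝ)) ∘ (extChartAt (staticModel s) p).symm
      =ᶠ[𝓝 q] Prod.fst := by
    filter_upwards [extChartAt_target_mem_nhds' hq] with z hz
    rw [extChartAt_prod] at hz
    rw [Function.comp_apply, extChartAt_static_symm_apply]
    exact coe_extChartAt_symm_openInterval p.1 hz.1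
  rw [heq.mfderiv_eq, mfderiv_eq_fderiv, fderiv_fst] at h
  exact (DFunLike.congr_fun h W).symm

theorem fiberProj_extChartAt_symm (W : ℝ × EuclideanSpace ℝ (Fin s)) :
    (fiberProj t₁ t₂ ((extChartAt (staticModel s) p).symm q)
      (mfderiv 𝓘(ℝ, ℝ × EuclideanSpace ℝ (Fin s)) (staticModel s)
        (extChartAt (staticModel s) p).symm q W) : EuclideanSpace ℝ (Fin s)) =
      mfderiv 𝓘(ℝ, EuclideanSpace ℝ (Fin s)) (𝓡 s) (extChartAt (𝓡 s) p.2).symm q.2 W.2 := by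
  have hdF : MDifferentiableAt 𝓘(ℝ, EuclideanSpace ℝ (Fin s)) (𝓡 s)
      (extChartAt (𝓡 s) p.2).symm q.2 := by
    rw [extChartAt_prod] at hq
    have h := mdifferentiableWithinAt_extChartAt_symm hq.2
    rwa [ModelWithCorners.range_eq_univ, mdifferentiableWithinAt_univ] at h
  have h := mfderiv_comp q (I' := staticModel s) (I'' := 𝓡 s) (g := Prod.snd) mdifferentiableAt_snd
    (mdifferentiableAt_extChartAt_static_symm p hq)
  have heq : Prod.snd ∘ (extChartAt (staticModel s) p).symm =
      (extChartAt (𝓡 s) p.2).symm ∘ Prod.snd := by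
    ext z
    rw [Function.comp_apply, extChartAt_static_symm_apply]
    rfl
  have h' := mfderiv_comp q (I := 𝓘(ℝ, ℝ × EuclideanSpace ℝ (Fin s))) hdF
    differentiableAt_snd.mdifferentiableAt
  rw [heq, h', mfderiv_eq_fderiv, fderiv_snd] at h
  exact (DFunLike.congr_fun h W).symm

/-- The bridge from the manifold to the model computation on ℝ × E. -/
theorem coordMetric_staticMetric (gF : MetricField (𝓡 s) F) (f : F → ℝ) :
    coordMetric (staticModel s) (staticMetric t₁ t₂ gF f) p q =
      staticCoord (coordMetric (𝓡 s) gF p.2) (f ∘ (extChartAt (𝓡 s) p.2).symm) q := by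
  refine ContinuousLinearMap.ext fun V => ContinuousLinearMap.ext fun W => ?_
  rw [coordMetric_apply, staticMetric_apply, timeForm_extChartAt_symm p hq,
    timeForm_extChartAt_symm p hq]
  refine congrArg₂ (· - ·) ?_ ?_
  · refine Eq.trans ?_ (coordMetric_apply (𝓡 s) gF p.2 q.2 V.2 W.2).symm
    exact congrArg₂ (fun a b => (gF _ : EuclideanSpace ℝ (Fin s) →L[ℝ]
      EuclideanSpace ℝ (Fin s) →L[ℝ] ℝ) a b)
      (fiberProj_extChartAt_symm p hq V) (fiberProj_extChartAt_symm p hq W)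
  · rw [extChartAt_static_symm_apply]
    rfl

end

theorem chartDeriv_static (p : openInterval t₁ t₂ × F) (w : TangentSpace (staticModel s) p) :
    chartDeriv (staticModel s) p w =
      (timeForm t₁ t₂ p w, chartDeriv (𝓡 s) p.2 (fiberProj t₁ t₂ p w)) := by
  have hF : MDifferentiableAt (𝓡 s) 𝓘(ℝ, EuclideanSpace ℝ (Fin s)) (extChartAt (𝓡 s) p.2) p.2 :=
    mdifferentiableAt_extChartAt (mem_chart_source _ _)
  have heq : (extChartAt (staticModel s) p : _ → ℝ × EuclideanSpace ℝ (Fin s)) =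
      fun q => ((q.1 : ℝ), extChartAt (𝓡 s) p.2 q.2) :=
    funext (extChartAt_static_apply p)
  have hsnd : HasMFDerivAt (staticModel s) 𝓘(ℝ, EuclideanSpace ℝ (Fin s))
      (fun q : openInterval t₁ t₂ × F => extChartAt (𝓡 s) p.2 q.2) p _ :=
    hF.hasMFDerivAt.comp p
      (mdifferentiableAt_snd (I := 𝓘(ℝ, ℝ)) (I' := 𝓡 s)).hasMFDerivAt
  have htime : HasMFDerivAt (staticModel s) 𝓘(ℝ, ℝ)
      (fun q : openInterval t₁ t₂ × F => (q.1 : ℝ)) p _ := (mdifferentiable_time p).hasMFDerivAt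
  have h : HasMFDerivAt (staticModel s) 𝓘(ℝ, ℝ × EuclideanSpace ℝ (Fin s))
      (fun q : openInterval t₁ t₂ × F => ((q.1 : ℝ), extChartAt (𝓡 s) p.2 q.2)) p
      (ContinuousLinearMap.prod _ _) := ⟨htime.1.prodMk hsnd.1, htime.2.prodMk hsnd.2⟩
  rw [← heq] at h
  have h' := h.mfderiv
  exact DFunLike.congr_fun h' w

end Static

/-- Positivity gives a trivial kernel, and E and its dual have the same finite dimension. -/
theorem isInvertible_of_pos {E : Type*} [NormedAddCommGroup E] [NormedSpace ℝ E]
    [FiniteDimensional ℝ E] {B : E →L[ℝ] E →L[ℝ] ℝ} (hB : ∀ v, v ≠ 0 → 0 < B v v) :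
    B.IsInvertible := by
  have hinj : Function.Injective (B : E →ₗ[ℝ] E →L[ℝ] ℝ) := by
    rw [← LinearMap.ker_eq_bot, LinearMap.ker_eq_bot']
    intro v hv
    by_contra h
    have h' := hB v h
    rw [show B v = 0 from hv] at h'
    simp at h'
  have hdim : Module.finrank ℝ E = Module.finrank ℝ (E →L[ℝ] ℝ) := by
    rw [← (LinearMap.toContinuousLinearMap : (E →ₗ[ℝ] ℝ) ≃ₗ[ℝ] (E →L[ℝ] ℝ)).finrank_eq]
    exact Subspace.dual_finrank_eq.symm
  have : FiniteDimensional ℝ (E →L[ℝ] ℝ) :=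
    (LinearMap.toContinuousLinearMap : (E →ₗ[ℝ] ℝ) ≃ₗ[ℝ] (E →L[ℝ] ℝ)).finiteDimensional
  exact ⟨((B : E →ₗ[ℝ] E →L[ℝ] ℝ).linearEquivOfInjective hinj hdim).toContinuousLinearEquiv, rfl⟩

/-! ### Regularity of a Riemannian metric in charts -/

section Manifolds

variable {E : Type*} [NormedAddCommGroup E] [NormedSpace ℝ E]
  {H : Type*} [TopologicalSpace H] {I : ModelWithCorners ℝ E H} [I.Boundaryless]
  {N : Type*} [TopologicalSpace N] [ChartedSpace H N] [IsManifold I ∞ N]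

theorem contMDiffAt_extChartAt_symm {x : N} {y : E} (hy : y ∈ (extChartAt I x).target) :
    ContMDiffAt 𝓘(ℝ, E) I ∞ (extChartAt I x).symm y :=
  (contMDiffOn_extChartAt_symm x).contMDiffAt (extChartAt_target_mem_nhds' hy)

theorem contDiffAt_comp_extChartAt_symm {f : N → ℝ} (hf : ContMDiff I 𝓘(ℝ, ℝ) ∞ f) (x : N)
    {n : ℕ} : ContDiffAt ℝ n (f ∘ (extChartAt I x).symm) (extChartAt I x x) := by
  have h := hf.contMDiffAt.comp (extChartAt I x x)
    (contMDiffAt_extChartAt_symm (I := I) (mem_extChartAt_target x))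
  exact (contMDiffAt_iff_contDiffAt.1 h).of_le (by exact_mod_cast le_top)

/-- The coordinate vector field of V is the tangent map of the smooth inverse chart applied to a
constant section. -/
theorem contMDiffAt_mfderiv_extChartAt_symm {x : N} {y : E}
    (hy : y ∈ (extChartAt I x).target) (V : E) :
    ContMDiffAt 𝓘(ℝ, E) I.tangent ∞ (fun z => (⟨(extChartAt I x).symm z,
      mfderiv 𝓘(ℝ, E) I (extChartAt I x).symm z V⟩ : TangentBundle I N)) y := by
  have hopen : IsOpen (extChartAt I x).target := isOpen_extChartAt_target x
  have h₁ := (contMDiffOn_extChartAt_symm (I := I) (n := ∞) x).contMDiffOn_tangentMapWithin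
    (m := ∞) (by simp) hopen.uniqueMDiffOn
  have h₂ : ContMDiffOn 𝓘(ℝ, E) 𝓘(ℝ, E).tangent ∞
      (fun z : E => (⟨z, V⟩ : TangentBundle 𝓘(ℝ, E) E)) (extChartAt I x).target := by
    intro z _
    exact (contMDiffAt_vectorSpace_iff_contDiffAt.2 contDiffAt_const).contMDiffWithinAt
  have h₃ := (h₁.comp h₂ fun z hz => hz).contMDiffAt (hopen.mem_nhds hy)
  refine h₃.congr_of_eventuallyEq ?_
  filter_upwards [hopen.mem_nhds hy] with z hz
  simp only [Function.comp_apply, tangentMapWithin, mfderivWithin_of_isOpen hopen hz]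

variable (g : Bundle.ContMDiffRiemannianMetric I ∞ E (fun x : N => TangentSpace I x))

theorem coordMetric_symm (x : N) (y u v : E) :
    coordMetric I g.inner x y u v = coordMetric I g.inner x y v u := by
  rw [coordMetric_apply, coordMetric_apply, g.symm]

variable [FiniteDimensional ℝ E]

theorem contDiffOn_coordMetric (x : N) :
    ContDiffOn ℝ ∞ (coordMetric I g.inner x) (extChartAt I x).target := by
  -- In finite dimension smoothness can be tested on constant V, W, that is, by evaluating the
  -- smooth bundle metric on coordinate vector fields.
  refine contDiffOn_clm_apply.2 fun V => contDiffOn_clm_apply.2 fun W => ?_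
  intro y hy
  refine ContDiffAt.contDiffWithinAt ?_
  rw [← contMDiffAt_iff_contDiffAt]
  have hb : ContMDiffAt 𝓘(ℝ, E) I ∞ (extChartAt I x).symm y :=
    contMDiffAt_extChartAt_symm hy
  have h : ContMDiffAt 𝓘(ℝ, E) (I.prod 𝓘(ℝ)) ∞
      (fun z ↦ Bundle.TotalSpace.mk' ℝ (E := Bundle.Trivial N ℝ) ((extChartAt I x).symm z)
        (g.inner ((extChartAt I x).symm z) (mfderiv 𝓘(ℝ, E) I (extChartAt I x).symm z V)
          (mfderiv 𝓘(ℝ, E) I (extChartAt I x).symm z W))) y := by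
    apply ContMDiffAt.clm_bundle_apply₂ (F₁ := E) (F₂ := E)
    · exact g.contMDiff.contMDiffAt.comp y hb
    · exact contMDiffAt_mfderiv_extChartAt_symm hy V
    · exact contMDiffAt_mfderiv_extChartAt_symm hy W
  simp only [Bundle.contMDiffAt_totalSpace] at h
  refine h.2.congr_of_eventuallyEq (Eventually.of_forall fun z => ?_)
  exact coordMetric_apply I g.inner x z V W

theorem contDiffAt_coordMetric (x : N) {n : ℕ} :
    ContDiffAt ℝ n (coordMetric I g.inner x) (extChartAt I x x) :=
  ((contDiffOn_coordMetric g x).contDiffAt (extChartAt_target_mem_nhds x)).of_le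
    (by exact_mod_cast le_top)

theorem isInvertible_coordMetric (x : N) :
    (coordMetric I g.inner x (extChartAt I x x)).IsInvertible := by
  refine isInvertible_of_pos fun v hv => ?_
  rw [coordMetric_apply]
  refine g.pos _ _ fun h => hv ?_
  have h' := isInvertible_mfderivWithin_extChartAt_symm (mem_extChartAt_target (I := I) x)
  rw [I.range_eq_univ, mfderivWithin_univ] at h'
  exact h'.injective (h.trans (map_zero _).symm)

end Manifolds

/-- The reverse Cauchy-Schwarz inequality in numbers: a, b₁, b₂ are the time parts of z, w₁, w₂; Z,
A₁, A₂ the squared norms of their fiber parts; c₁, c₂, d the fiber products of z with w₁, of z with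
w₂, and of w₁ with w₂. Time parts dominate fiber parts, so it suffices that b₁ and b₂ have the same
sign. -/
theorem le_of_mem_same_cone {f a b₁ b₂ Z A₁ A₂ c₁ c₂ d : ℝ} (hf : 0 < f)
    (hz : Z - f ^ 2 * (a * a) < 0) (hA₁ : A₁ - f ^ 2 * (b₁ * b₁) ≤ 0)
    (hA₂ : A₂ - f ^ 2 * (b₂ * b₂) ≤ 0) (hc₁ : c₁ - f ^ 2 * (a * b₁) < 0)
    (hc₂ : c₂ - f ^ 2 * (a * b₂) < 0) (hA₁' : 0 ≤ A₁) (hA₂' : 0 ≤ A₂)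
    (h₁ : c₁ ^ 2 ≤ Z * A₁) (h₂ : c₂ ^ 2 ≤ Z * A₂) (hd : d ^ 2 ≤ A₁ * A₂) :
    d - f ^ 2 * (b₁ * b₂) ≤ 0 := by
  have hf2 : 0 < f ^ 2 := by positivity
  have key (b A c : ℝ) (hA : A - f ^ 2 * (b * b) ≤ 0) (hc : c - f ^ 2 * (a * b) < 0)
      (hA' : 0 ≤ A) (h : c ^ 2 ≤ Z * A) : 0 < a * b := by
    -- If ab ≤ 0, then c < f²ab ≤ 0 gives c² > (f²ab)², against Cauchy-Schwarz and the causality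
    -- bounds.
    by_contra! hab
    have h₃ : c ^ 2 ≤ (f ^ 2 * (a * b)) ^ 2 :=
      calc c ^ 2 ≤ Z * A := h
        _ ≤ (f ^ 2 * (a * a)) * (f ^ 2 * (b * b)) :=
          mul_le_mul (by linarith) (by linarith) hA'
            (mul_nonneg hf2.le (mul_self_nonneg a))
        _ = (f ^ 2 * (a * b)) ^ 2 := by ring
    have h₄ : f ^ 2 * (a * b) ≤ 0 := mul_nonpos_of_nonneg_of_nonpos hf2.le hab
    nlinarith
  have hb : 0 < b₁ * b₂ := by
    have h := mul_pos (key b₁ A₁ c₁ hA₁ hc₁ hA₁' h₁) (key b₂ A₂ c₂ hA₂ hc₂ hA₂' h₂)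
    refine pos_of_mul_pos_right (a := a ^ 2) ?_ (sq_nonneg a)
    linarith
  have hd' : d ^ 2 ≤ (f ^ 2 * (b₁ * b₂)) ^ 2 :=
    calc d ^ 2 ≤ A₁ * A₂ := hd
      _ ≤ (f ^ 2 * (b₁ * b₁)) * (f ^ 2 * (b₂ * b₂)) :=
        mul_le_mul (by linarith) (by linarith) hA₂' (mul_nonneg hf2.le (mul_self_nonneg b₁))
      _ = (f ^ 2 * (b₁ * b₂)) ^ 2 := by ring
  linarith [le_abs_self d, abs_le_of_sq_le_sq hd' (by positivity)]

/-! ### Causal vectors and curvature of the space-time -/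

section Static

variable {s : ℕ} {t₁ t₂ : EReal} {F : Type*} [TopologicalSpace F]
  [ChartedSpace (EuclideanSpace ℝ (Fin s)) F]

theorem fiberProj_sumVector [IsManifold (𝓡 s) ∞ F] (t : openInterval t₁ t₂) (x : F)
    (u : TangentSpace 𝓘(ℝ, ℝ) t)    (v : TangentSpace (𝓡 s) x) : fiberProj t₁ t₂ (t, x) (sumVector t₁ t₂ t x u v) = v := by
  rw [fiberProj, sumVector, mfderiv_snd, mfderiv_prod_left, mfderiv_prod_right]
  exact zero_add v

/-- The inclusion of the interval into ℝ is its chart, so its differential is onto and the time part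
can be prescribed independently of the fiber part. -/
theorem exists_timeForm_fiberProj_eq [IsManifold (𝓡 s) ∞ F] (p : openInterval t₁ t₂ × F) (b : ℝ)
    (v : TangentSpace (𝓡 s) p.2) : ∃ w : TangentSpace (staticModel s) p,
      timeForm t₁ t₂ p w = b ∧ fiberProj t₁ t₂ p w = v := by
  have hval : (mfderiv 𝓘(ℝ, ℝ) 𝓘(ℝ, ℝ) (fun t : openInterval t₁ t₂ => (t : ℝ))
      p.1).IsInvertible := by
    have h := isInvertible_mfderiv_extChartAt (I := 𝓘(ℝ, ℝ))
      (mem_extChartAt_source (I := 𝓘(ℝ, ℝ)) p.1)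
    rwa [show (extChartAt 𝓘(ℝ, ℝ) p.1 : openInterval t₁ t₂ → ℝ) = fun t => t.1 from
      funext (extChartAt_openInterval p.1)] at h
  obtain ⟨u, hu⟩ := hval.surjective b
  refine ⟨sumVector t₁ t₂ p.1 p.2 u v, ?_, fiberProj_sumVector p.1 p.2 u v⟩
  have h : timeForm t₁ t₂ p = _ :=
    mfderiv_comp p (I' := 𝓘(ℝ, ℝ)) (mdifferentiable_openInterval_coe p.1)
      (mdifferentiableAt_fst (I := 𝓘(ℝ, ℝ)) (I' := 𝓡 s))
  rw [h, sumVector, mfderiv_fst, mfderiv_prod_left, mfderiv_prod_right, ← hu]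
  exact congrArg _ (add_zero u)

variable [IsManifold (𝓡 s) ∞ F]
  (gF : Bundle.ContMDiffRiemannianMetric (𝓡 s) ∞ (EuclideanSpace ℝ (Fin s))
    (fun x : F => TangentSpace (𝓡 s) x))

theorem inner_self_nonneg (x : F) (v : TangentSpace (𝓡 s) x) : 0 ≤ gF.inner x v v := by
  by_cases hv : v = 0
  · simp [hv]
  · exact (gF.pos x v hv).le

theorem inner_sq_le (x : F) (v w : TangentSpace (𝓡 s) x) :
    gF.inner x v w ^ 2 ≤ gF.inner x v v * gF.inner x w w := by
  by_cases hw : w = 0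
  · simp [hw]
  have hpos := gF.pos x w hw
  -- The squared norm of this vector is |w|² (|v|² |w|² - ⟨v, w⟩²).
  have h := inner_self_nonneg gF x (gF.inner x w w • v - gF.inner x v w • w)
  simp only [map_sub, map_smul, sub_apply, smul_apply, smul_eq_mul, gF.symm x w v] at h
  refine le_of_sub_nonneg (nonneg_of_mul_nonneg_right ?_ hpos)
  linarith

variable {f : F → ℝ}

theorem staticMetric_nonpos_of_sameTimeCone (hf_pos : ∀ x, 0 < f x) (p : openInterval t₁ t₂ × F)
    {w₁ w₂ : TangentSpace (staticModel s) p}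
    (h₁ : IsCausal (staticModel s) (staticMetric t₁ t₂ gF.inner f) w₁)
    (h₂ : IsCausal (staticModel s) (staticMetric t₁ t₂ gF.inner f) w₂)
    (h : SameTimeCone (staticModel s) (staticMetric t₁ t₂ gF.inner f) w₁ w₂) :
    staticMetric t₁ t₂ gF.inner f p w₁ w₂ ≤ 0 := by
  obtain ⟨z, hz, hz₁, hz₂⟩ := h
  have h₁' := h₁.2
  have h₂' := h₂.2
  rw [staticMetric_apply] at *
  exact le_of_mem_same_cone (hf_pos p.2) hz h₁' h₂' hz₁ hz₂ (inner_self_nonneg gF _ _)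
    (inner_self_nonneg gF _ _) (inner_sq_le gF _ _ _) (inner_sq_le gF _ _ _) (inner_sq_le gF _ _ _)

theorem coordMetric_staticMetric_eventuallyEq (f : F → ℝ) (p : openInterval t₁ t₂ × F) :
    coordMetric (staticModel s) (staticMetric t₁ t₂ gF.inner f) p
      =ᶠ[𝓝 ((p.1 : ℝ), extChartAt (𝓡 s) p.2 p.2)]
        staticCoord (coordMetric (𝓡 s) gF.inner p.2) (f ∘ (extChartAt (𝓡 s) p.2).symm) := by
  rw [← extChartAt_static_apply]
  filter_upwards [extChartAt_target_mem_nhds p] with q hq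
  exact coordMetric_staticMetric p hq gF.inner f

theorem ricci_staticMetric (hf : ContMDiff (𝓡 s) 𝓘(ℝ, ℝ) ∞ f) (hf_pos : ∀ x, 0 < f x)
    (p : openInterval t₁ t₂ × F) (w₁ w₂ : TangentSpace (staticModel s) p) :
    ricci (staticModel s) (staticMetric t₁ t₂ gF.inner f) p w₁ w₂ =
      ricci (𝓡 s) gF.inner p.2 (fiberProj t₁ t₂ p w₁) (fiberProj t₁ t₂ p w₂) -
        (f p.2)⁻¹ *
          hessian (𝓡 s) gF.inner f p.2 (fiberProj t₁ t₂ p w₁) (fiberProj t₁ t₂ p w₂) +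
        timeForm t₁ t₂ p w₁ * timeForm t₁ t₂ p w₂ * f p.2 * laplacian (𝓡 s) gF.inner f p.2 := by
  have hfx : (f ∘ (extChartAt (𝓡 s) p.2).symm) (extChartAt (𝓡 s) p.2 p.2) = f p.2 := by simp
  have key := coordRicci_staticCoord (q := ((p.1 : ℝ), extChartAt (𝓡 s) p.2 p.2))
    (contDiffAt_coordMetric gF p.2 (n := 2)) (contDiffAt_comp_extChartAt_symm hf p.2 (n := 2))
    (Eventually.of_forall (coordMetric_symm gF p.2)) (isInvertible_coordMetric gF p.2)
    (by rw [hfx]; exact (hf_pos _).ne') (chartDeriv (staticModel s) p w₁)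
    (chartDeriv (staticModel s) p w₂)
  rw [hfx, ← coordRicci_congr (coordMetric_staticMetric_eventuallyEq gF f p)] at key
  rw [ricci, LinearMap.compl₁₂_apply, extChartAt_static_apply, key, chartDeriv_static,
    chartDeriv_static]
  rfl

theorem scalarCurvature_staticMetric (hf : ContMDiff (𝓡 s) 𝓘(ℝ, ℝ) ∞ f) (hf_pos : ∀ x, 0 < f x)
    (p : openInterval t₁ t₂ × F) :
    scalarCurvature (staticModel s) (staticMetric t₁ t₂ gF.inner f) p =
      scalarCurvature (𝓡 s) gF.inner p.2 -
        2 * (f p.2)⁻¹ * laplacian (𝓡 s) gF.inner f p.2 := by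
  have hfx : (f ∘ (extChartAt (𝓡 s) p.2).symm) (extChartAt (𝓡 s) p.2 p.2) = f p.2 := by simp
  have key := metricTrace_coordRicci_staticCoord (q := ((p.1 : ℝ), extChartAt (𝓡 s) p.2 p.2))
    (contDiffAt_coordMetric gF p.2 (n := 2)) (contDiffAt_comp_extChartAt_symm hf p.2 (n := 2))
    (Eventually.of_forall (coordMetric_symm gF p.2)) (isInvertible_coordMetric gF p.2)
    (by rw [hfx]; exact (hf_pos _).ne')
  have heq := coordMetric_staticMetric_eventuallyEq gF f p
  rw [hfx, ← coordRicci_congr heq, ← heq.eq_of_nhds] at key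
  rw [scalarCurvature, extChartAt_static_apply, key]
  rfl

/-- The energy-momentum tensor of a standard static space-time in terms of the fiber. -/
theorem energyMomentum_staticMetric (hf : ContMDiff (𝓡 s) 𝓘(ℝ, ℝ) ∞ f) (hf_pos : ∀ x, 0 < f x)
    (p : openInterval t₁ t₂ × F) (w₁ w₂ : TangentSpace (staticModel s) p) :
    8 * Real.pi * energyMomentum (staticModel s) (staticMetric t₁ t₂ gF.inner f) p w₁ w₂ =
      -(1 / 2) * scalarCurvature (𝓡 s) gF.inner p.2 * staticMetric t₁ t₂ gF.inner f p w₁ w₂ -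
        1 / f p.2 *
          tensorLstar (𝓡 s) gF.inner f p.2 (fiberProj t₁ t₂ p w₁) (fiberProj t₁ t₂ p w₂) := by
  have hπ := Real.pi_ne_zero
  have hf₀ := (hf_pos p.2).ne'
  rw [energyMomentum, ricci_staticMetric gF hf hf_pos, scalarCurvature_staticMetric gF hf hf_pos,
    staticMetric_apply, tensorLstar]
  field_simp
  ring

end Static

/-! ### Ricci flat fibers and causal lifts -/

section Static

variable {s : ℕ} {t₁ t₂ : EReal} {F : Type*} [TopologicalSpace F]
  [ChartedSpace (EuclideanSpace ℝ (Fin s)) F]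

theorem nonempty_openInterval (ht : t₁ < t₂) : Nonempty (openInterval t₁ t₂) :=
  let ⟨t, h₁, h₂⟩ := EReal.lt_iff_exists_real_btwn.1 ht
  ⟨⟨t, h₁, h₂⟩⟩

theorem tensorQ_eq_neg_tensorLstar {g : MetricField (𝓡 s) F}
    (h : ∀ x v w, ricci (𝓡 s) g x v w = 0) (f : F → ℝ) (x : F) (v w : TangentSpace (𝓡 s) x) :
    tensorQ (𝓡 s) g f x v w = -tensorLstar (𝓡 s) g f x v w := by
  rw [tensorQ, tensorLstar, h]
  ring

theorem energyMomentum_nonneg_iff (g : MetricField (staticModel s) (openInterval t₁ t₂ × F))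
    (p : openInterval t₁ t₂ × F) (w₁ w₂ : TangentSpace (staticModel s) p) :
    0 ≤ energyMomentum (staticModel s) g p w₁ w₂ ↔
      0 ≤ 8 * Real.pi * energyMomentum (staticModel s) g p w₁ w₂ :=
  (mul_nonneg_iff_of_pos_left (by positivity)).symm

variable [IsManifold (𝓡 s) ∞ F]

/-- The differential of the chart is onto, so a vanishing Ricci tensor also vanishes in coordinates,
where the trace is taken. -/
theorem scalarCurvature_eq_zero_of_ricci (g : MetricField (𝓡 s) F) (x : F)
    (h : ∀ v w, ricci (𝓡 s) g x v w = 0) : scalarCurvature (𝓡 s) g x = 0 := by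
  have hsurj : Function.Surjective (chartDeriv (𝓡 s) x) :=
    (isInvertible_mfderiv_extChartAt (mem_extChartAt_source x)).surjective
  have hR : coordRicci (coordMetric (𝓡 s) g x) (extChartAt (𝓡 s) x x) = 0 := by
    refine LinearMap.ext fun v => LinearMap.ext fun w => ?_
    obtain ⟨v, rfl⟩ := hsurj v
    obtain ⟨w, rfl⟩ := hsurj w
    exact h v w
  rw [scalarCurvature, hR, metricTrace, LinearMap.comp_zero, LinearMap.comp_zero, map_zero]

variable (gF : Bundle.ContMDiffRiemannianMetric (𝓡 s) ∞ (EuclideanSpace ℝ (Fin s))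
    (fun x : F => TangentSpace (𝓡 s) x)) {f : F → ℝ}

/-- Vectors with a prescribed fiber part and a large time part are causal and future-directed. -/
theorem exists_causal_lift (hf_pos : ∀ x, 0 < f x) (p : openInterval t₁ t₂ × F)
    (v₁ v₂ : TangentSpace (𝓡 s) p.2) :
    ∃ w₁ w₂ : TangentSpace (staticModel s) p,
      fiberProj t₁ t₂ p w₁ = v₁ ∧ fiberProj t₁ t₂ p w₂ = v₂ ∧
      staticMetric t₁ t₂ gF.inner f p w₁ w₁ < 0 ∧
      IsCausal (staticModel s) (staticMetric t₁ t₂ gF.inner f) w₁ ∧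
      IsCausal (staticModel s) (staticMetric t₁ t₂ gF.inner f) w₂ ∧
      SameTimeCone (staticModel s) (staticMetric t₁ t₂ gF.inner f) w₁ w₂ := by
  have hf := hf_pos p.2
  have hA := inner_self_nonneg gF p.2 v₁
  have hB := inner_self_nonneg gF p.2 v₂
  set A := gF.inner p.2 v₁ v₁ with hA_def
  set B := gF.inner p.2 v₂ v₂ with hB_def
  -- A common time part with (f b)² = (1 + A + B)², larger than both A and B, makes both lifts
  -- time-like.
  set b : ℝ := (1 + A + B) / f p.2 with hb_def
  have hb : 0 < b := by positivity
  have hfb : f p.2 ^ 2 * (b * b) = (1 + A + B) ^ 2 := by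
    rw [hb_def]
    field_simp
  obtain ⟨w₁, hw₁, hv₁⟩ := exists_timeForm_fiberProj_eq p b v₁
  obtain ⟨w₂, hw₂, hv₂⟩ := exists_timeForm_fiberProj_eq p b v₂
  -- z is the vector ∂ₜ; it pairs with either lift to -f² b < 0.
  obtain ⟨z, hz, hz'⟩ := exists_timeForm_fiberProj_eq p 1 (0 : TangentSpace (𝓡 s) p.2)
  have hne (w : TangentSpace (staticModel s) p) (hw : timeForm t₁ t₂ p w = b) : w ≠ 0 := by
    rintro rfl
    rw [map_zero] at hw
    exact hb.ne hw
  have h₁ : staticMetric t₁ t₂ gF.inner f p w₁ w₁ < 0 := by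
    rw [staticMetric_apply, hv₁, hw₁, hfb, ← hA_def]
    nlinarith [mul_nonneg hA hB]
  have h₂ : staticMetric t₁ t₂ gF.inner f p w₂ w₂ < 0 := by
    rw [staticMetric_apply, hv₂, hw₂, hfb, ← hB_def]
    nlinarith [mul_nonneg hA hB]
  refine ⟨w₁, w₂, hv₁, hv₂, h₁, ⟨hne w₁ hw₁, h₁.le⟩, ⟨hne w₂ hw₂, h₂.le⟩, z, ?_, ?_, ?_⟩
  · rw [staticMetric_apply, hz, hz']
    simp only [map_zero]
    linarith [show 0 < f p.2 ^ 2 * (1 * 1) by positivity]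
  · rw [staticMetric_apply, hz, hz', hw₁]
    simp only [map_zero, zero_apply]
    linarith [show 0 < f p.2 ^ 2 * (1 * b) by positivity]
  · rw [staticMetric_apply, hz, hz', hw₂]
    simp only [map_zero, zero_apply]
    linarith [show 0 < f p.2 ^ 2 * (1 * b) by positivity]

end Static

end StaticSpacetime
end
open StaticSpacetime in
theorem mainTheorem9 (s : ℕ) (t₁ t₂ : EReal) (ht : t₁ < t₂)
    (F : Type*) [TopologicalSpace F] [ChartedSpace (EuclideanSpace ℝ (Fin s)) F]
    [IsManifold (𝓡 s) ∞ F]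
    (gF : Bundle.ContMDiffRiemannianMetric (𝓡 s) ∞ (EuclideanSpace ℝ (Fin s))
      (fun x : F => TangentSpace (𝓡 s) x))
    (f : F → ℝ) (hf : ContMDiff (𝓡 s) 𝓘(ℝ, ℝ) ∞ f) (hf_pos : ∀ x, 0 < f x) :
    ((∀ x v w, tensorLstar (𝓡 s) gF.inner f x v w = 0) →
      (∀ (p : openInterval t₁ t₂ × F) (w₁ w₂ : TangentSpace (staticModel s) p),
        8 * Real.pi * energyMomentum (staticModel s) (staticMetric t₁ t₂ gF.inner f) p w₁ w₂ =
          -(1 / 2) * scalarCurvature (𝓡 s) gF.inner p.2 *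
            staticMetric t₁ t₂ gF.inner f p w₁ w₂) ∧
      (DominantCondition (staticModel s) (staticMetric t₁ t₂ gF.inner f) ↔
        ∀ x, 0 ≤ scalarCurvature (𝓡 s) gF.inner x)) ∧
    ((∀ x v w, ricci (𝓡 s) gF.inner x v w = 0) →
      (∀ (t : openInterval t₁ t₂) (x : F) (u₁ u₂ : TangentSpace 𝓘(ℝ, ℝ) t)
        (v₁ v₂ : TangentSpace (𝓡 s) x),
        8 * Real.pi * energyMomentum (staticModel s) (staticMetric t₁ t₂ gF.inner f) (t, x)
            (sumVector t₁ t₂ t x u₁ v₁) (sumVector t₁ t₂ t x u₂ v₂) =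
          1 / f x * tensorQ (𝓡 s) gF.inner f x v₁ v₂) ∧
      (DominantCondition (staticModel s) (staticMetric t₁ t₂ gF.inner f) ↔
        ∀ x v w, tensorQ (𝓡 s) gF.inner f x v w = 0) ∧
      ((∀ x v w, tensorQ (𝓡 s) gF.inner f x v w = 0) ↔
        ∀ x v w, tensorLstar (𝓡 s) gF.inner f x v w = 0)) := by
  obtain ⟨t₀⟩ := nonempty_openInterval ht
  constructor
  · intro hL
    have hT (p : openInterval t₁ t₂ × F) (w₁ w₂ : TangentSpace (staticModel s) p) :
        8 * Real.pi * energyMomentum (staticModel s) (staticMetric t₁ t₂ gF.inner f) p w₁ w₂ =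
          -(1 / 2) * scalarCurvature (𝓡 s) gF.inner p.2 *
            staticMetric t₁ t₂ gF.inner f p w₁ w₂ := by
      rw [energyMomentum_staticMetric gF hf hf_pos, hL, mul_zero, sub_zero]
    refine ⟨hT, fun hD x => ?_, fun hτ p w₁ w₂ h₁ h₂ h => ?_⟩
    -- Testing a time-like w against itself suffices: from g(w, w) < 0 and -½ τ_F g(w, w) ≥ 0
    -- follows τ_F ≥ 0.
    · obtain ⟨w, -, -, -, hg, hw, -, z, hz, hzw, -⟩ := exists_causal_lift gF hf_pos (t₀, x) 0 0
      have h := (energyMomentum_nonneg_iff _ _ _ _).1 (hD (t₀, x) w w hw hw ⟨z, hz, hzw, hzw⟩)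
      rw [hT] at h
      have h' := nonpos_of_mul_nonneg_left h hg
      linarith
    · rw [energyMomentum_nonneg_iff, hT]
      refine mul_nonneg_of_nonpos_of_nonpos ?_
        (staticMetric_nonpos_of_sameTimeCone gF hf_pos p h₁ h₂ h)
      linarith [hτ p.2]
  · intro hR
    have hT (p : openInterval t₁ t₂ × F) (w₁ w₂ : TangentSpace (staticModel s) p) :
        8 * Real.pi * energyMomentum (staticModel s) (staticMetric t₁ t₂ gF.inner f) p w₁ w₂ =
          1 / f p.2 * tensorQ (𝓡 s) gF.inner f p.2 (fiberProj t₁ t₂ p w₁)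
            (fiberProj t₁ t₂ p w₂) := by
      rw [energyMomentum_staticMetric gF hf hf_pos,
        scalarCurvature_eq_zero_of_ricci gF.inner p.2 (hR p.2), tensorQ_eq_neg_tensorLstar hR]
      ring
    refine ⟨fun t x u₁ u₂ v₁ v₂ => ?_, ⟨fun hD x v w => ?_, fun hQ p w₁ w₂ _ _ _ => ?_⟩, ?_⟩
    · rw [hT, fiberProj_sumVector, fiberProj_sumVector]
    · have hQ (v w : TangentSpace (𝓡 s) x) : 0 ≤ tensorQ (𝓡 s) gF.inner f x v w := by
        obtain ⟨w₁, w₂, h₁, h₂, -, hw₁, hw₂, h⟩ := exists_causal_lift gF hf_pos (t₀, x) v w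
        have h' := (energyMomentum_nonneg_iff _ _ _ _).1 (hD (t₀, x) w₁ w₂ hw₁ hw₂ h)
        rw [hT, h₁, h₂] at h'
        exact nonneg_of_mul_nonneg_right h' (one_div_pos.2 (hf_pos x))
      refine le_antisymm ?_ (hQ v w)
      -- Q is linear in its second argument, so nonnegativity at -w gives the opposite inequality at
      -- w.
      have h := hQ v (-w)
      simp only [tensorQ, map_neg] at h ⊢
      linarith
    · rw [energyMomentum_nonneg_iff, hT, hQ, mul_zero]
    · simp only [tensorQ_eq_neg_tensorLstar hR, neg_eq_zero]
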